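/- Let $q$ be a power of a prime, let $n\ge 1$ be an integer with $\gcd(n,q)=1$, let $m=\mathrm{ord}_n(q^2)$ be the multiplicative order of $q^2$ modulo $n$, and let $\delta$ be an integer with $$2\le\delta\le\delta_{\max}=\left\lfloor \frac{n(q^m-1)}{q^{2m}-1}\right\rfloor .$$ Notation. Let $\mathbb F_q$ have characteristic $p$, let $\omega=e^{2\pi i/p}$, and let $\mathrm{tr}$ be the trace from $\mathbb F_q$ to $\mathbb F_p$. On $\mathbb C^{q^n}=(\mathbb C^q)^{\otimes n}$, with orthonormal basis $|x\rangle$, $x\in\mathbb F_q^n$, put $X(a)|x\rangle=|x+a\rangle$ and $Z(b)|x\rangle=\omega^{\mathrm{tr}(b\cdot x)}|x\rangle$ for $a,b\in\mathbb F_q^n$; the weight of the error $E=X(a)Z(b)$ is the number of $i$ with $(a_i,b_i)\ne(0,0)$. An $[[n,k,r,\ge d]]_q$ subsystem code is a subspace $Q\subseteq\mathbb C^{q^n}$ with an isometric identification $Q=A\otimes B$, $\dim A=q^k$, $\dim B=q^r$, such that every error $E$ of weight less than $d$ is detectable on $A$: $PEP|_Q=1_A\otimes T_E$ for some operator $T_E$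 on $B$, where $P$ is the orthogonal projection onto $Q$. It is pure up to $d$ if $PEP=0$ for every error $E$ of weight at least $1$ and less than $d$. For a code $C\subseteq\mathbb F_{q^2}^n$ let $C^{\perp_h}=\{x : \sum_i x_ic_i^q=0 \text{ for all } c\in C\}$ be its Hermitian dual. A narrow-sense BCH code of length $n$ and designed distance $\delta$ over $\mathbb F_{q^2}$ is a code of the form $\{c\in\mathbb F_{q^2}^n : \sum_{i=0}^{n-1} c_i\beta^{ij}=0 \text{ for } 1\le j\le\delta-1\}$, where $\beta$ is a primitive $n$-th root of unity in an extension field. Then there is a narrow-sense BCH code $C$ of length $n$ and designed distance $\delta$ over $\mathbb F_{q^2}$ with $C^{\perp_h}\subseteq C$ and $\dim C=n-m\lceil(\delta-1)(1-1/q^2)\rceil$ such that, for every integer $r$ with $0\le r<n-2m\lceil(\delta-1)(1-1/q^2)\rceil$, there exists a subsystem code $Q$ with parameters $$[[\,n,\;n-2m\lceil(\delta-1)(1-1/q^2)\rceil-r,\;r,\;\ge\delta\,]]_q$$ that is pure up to $\delta$ and whose code space $Q$ is the stabilizer code obtained from $C$ by the Hermitian construction: for some $\gamma\in\mathbb F_{q^2}$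 such that $\gamma,\gamma^q$ is a basis of $\mathbb F_{q^2}$ over $\mathbb F_q$, $Q$ is a joint eigenspace of all operators $X(a)Z(b)$ with $\gamma a+\gamma^q b\in C^{\perp_h}$. -/

import Mathlib

open scoped TensorProduct

noncomputable section

/-- `ω ^ tr x`, where `tr` is the trace from the finite field `F` to its prime field `ZMod p` and
`ω = exp (2 π i / p)`. -/
def traceCharacter (F : Type*) [Field F] [Fintype F] (x : F) : ℂ :=
  haveI : NeZero (ringChar F) := ⟨CharP.ringChar_ne_zero_of_finite F⟩
  letI : Algebra (ZMod (ringChar F)) F := ZMod.algebra F (ringChar F)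
  ZMod.stdAddChar (Algebra.trace (ZMod (ringChar F)) F x)

/-- The Hilbert space `ℂ^q ⊗ ⋯ ⊗ ℂ^q` (`n` factors, `q = #F`), with orthonormal basis
`|x⟩ = |x₁⟩ ⊗ ⋯ ⊗ |xₙ⟩` labelled by the vectors `x ∈ Fⁿ`. -/
abbrev QuditSpace (F : Type*) [Field F] [Fintype F] (n : ℕ) : Type _ :=
  EuclideanSpace ℂ (Fin n → F)

/-- The basis vector `|x⟩`. -/
def quditKet {F : Type*} [Field F] [Fintype F] {n : ℕ} (x : Fin n → F) : QuditSpace F n :=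
  open Classical in EuclideanSpace.single x 1

/-- The error operator `X(a) = X(a₁) ⊗ ⋯ ⊗ X(aₙ)`, which maps `|x⟩` to `|x + a⟩`. -/
def errorX {F : Type*} [Field F] [Fintype F] {n : ℕ} (a : Fin n → F) :
    QuditSpace F n →ₗ[ℂ] QuditSpace F n where
  toFun v := WithLp.toLp 2 fun y => v (y - a)
  map_add' _ _ := rfl
  map_smul' _ _ := rfl

/-- The error operator `Z(b) = Z(b₁) ⊗ ⋯ ⊗ Z(bₙ)`, which maps `|x⟩` to
`ω ^ tr (b₁ x₁ + ⋯ + bₙ xₙ) |x⟩`. -/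
def errorZ {F : Type*} [Field F] [Fintype F] {n : ℕ} (b : Fin n → F) :
    QuditSpace F n →ₗ[ℂ] QuditSpace F n where
  toFun v := WithLp.toLp 2 fun y => traceCharacter F (∑ i, b i * y i) * v y
  map_add' _ _ := by ext y; simp [mul_add]
  map_smul' _ _ := by ext y; simp [mul_left_comm]

theorem errorX_quditKet {F : Type*} [Field F] [Fintype F] {n : ℕ} (a x : Fin n → F) :
    errorX a (quditKet x) = quditKet (x + a) := by
  classical
  ext y
  change quditKet x (y - a) = quditKet (x + a) y
  simp [quditKet, Pi.single_apply, sub_eq_iff_eq_add]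

theorem errorZ_quditKet {F : Type*} [Field F] [Fintype F] {n : ℕ} (b x : Fin n → F) :
    errorZ b (quditKet x) = traceCharacter F (∑ i, b i * x i) • quditKet x := by
  classical
  ext y
  by_cases h : y = x
  · subst h; simp [errorZ, quditKet]
  · simp [errorZ, quditKet, h]

/-- The weight of the error `X(a) Z(b)`: the number of qudits on which it acts nontrivially. -/
def errorWeight {F : Type*} [Field F] {n : ℕ} (a b : Fin n → F) : ℕ :=
  {i : Fin n | a i ≠ 0 ∨ b i ≠ 0}.ncard

/-- A subspace `Q` of `(ℂ^q)^{⊗ n}`, `q = #F`, with a decomposition `Q = A ⊗ B` into Hilbert spaces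
`A` of dimension `q ^ k` (the information) and `B` of dimension `q ^ r` (the gauge). -/
structure SubsystemCode (F : Type*) [Field F] [Fintype F] (n k r : ℕ) where
  /-- The code space `Q`. -/
  space : Submodule ℂ (QuditSpace F n)
  /-- The identification of `A ⊗ B` with `Q`. -/
  decomp : (EuclideanSpace ℂ (Fin (Fintype.card F ^ k)) ⊗[ℂ]
    EuclideanSpace ℂ (Fin (Fintype.card F ^ r))) ≃ₗᵢ[ℂ] space

/-- The operator `E` is detectable on the subsystem `A` of `Q = A ⊗ B`: with `P` the orthogonal
projection onto `Q`, the compression `P E P` is `1 ⊗ T` on `A ⊗ B` for some operator `T` on `B`. -/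
def SubsystemCode.Detects {F : Type*} [Field F] [Fintype F] {n k r : ℕ}
    (S : SubsystemCode F n k r) (E : QuditSpace F n →ₗ[ℂ] QuditSpace F n) : Prop :=
  ∃ T : EuclideanSpace ℂ (Fin (Fintype.card F ^ r)) →ₗ[ℂ]
      EuclideanSpace ℂ (Fin (Fintype.card F ^ r)),
    ∀ u, S.space.starProjection (E (S.decomp u)) = S.decomp (LinearMap.lTensor _ T u)

/-- The minimum distance is at least `d`: every error of weight less than `d` is detectable on the
subsystem `A`. -/
def SubsystemCode.DistanceGE {F : Type*} [Field F] [Fintype F] {n k r : ℕ}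
    (S : SubsystemCode F n k r) (d : ℕ) : Prop :=
  ∀ a b : Fin n → F, errorWeight a b < d → S.Detects (errorX a ∘ₗ errorZ b)

/-- Purity up to `d`: every nonscalar error `X(a) Z(b)` of weight less than `d` maps the code space
`Q` to its orthogonal complement, that is, `P E P = 0`. -/
def SubsystemCode.PureTo {F : Type*} [Field F] [Fintype F] {n k r : ℕ}
    (S : SubsystemCode F n k r) (d : ℕ) : Prop :=
  ∀ a b : Fin n → F, 0 < errorWeight a b → errorWeight a b < d →
    ∀ v ∈ S.space, errorX a (errorZ b v) ∈ S.spaceᗮ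

/-- The cyclic code over `K` of length `n` of all `c` with
`c(β) = c(β ^ 2) = ⋯ = c(β ^ (δ - 1)) = 0`, where `c(x) = c₀ + c₁ x + ⋯ + cₙ₋₁ x ^ (n - 1)`. -/
def bchCode {K L : Type*} [Field K] [Field L] [Algebra K L] (n δ : ℕ) (β : L) :
    Submodule K (Fin n → K) where
  carrier := {c | ∀ j : ℕ, 1 ≤ j → j < δ → ∑ i, algebraMap K L (c i) * (β ^ j) ^ (i : ℕ) = 0}
  zero_mem' := by intro j _ _; simp
  add_mem' := by
    intro c c' hc hc' j h1 h2
    simp [add_mul, Finset.sum_add_distrib, hc j h1 h2, hc' j h1 h2]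
  smul_mem' := by
    intro t c hc j h1 h2
    simp [mul_assoc, ← Finset.mul_sum, hc j h1 h2]

/-- `C` is a narrow-sense BCH code of length `n` and designed distance `δ` over `K`, with respect
to some primitive `n`-th root of unity in an algebraic closure of `K`. -/
def IsNarrowSenseBCH {K : Type*} [Field K] {n : ℕ} (δ : ℕ) (C : Submodule K (Fin n → K)) : Prop :=
  ∃ β : AlgebraicClosure K, IsPrimitiveRoot β n ∧ C = bchCode n δ β

/-- The Hermitian dual `{x | x₁ c₁ ^ q + ⋯ + xₙ cₙ ^ q = 0 for all c ∈ C}` of a code `C` over a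
field of order `q ^ 2`. -/
def hermitianDual {K : Type*} [Field K] {n : ℕ} (q : ℕ) (C : Submodule K (Fin n → K)) :
    Submodule K (Fin n → K) where
  carrier := {x | ∀ c ∈ C, ∑ i, x i * c i ^ q = 0}
  zero_mem' := by intro c _; simp
  add_mem' := by
    intro x x' hx hx' c hc
    simp [add_mul, Finset.sum_add_distrib, hx c hc, hx' c hc]
  smul_mem' := by
    intro t x hx c hc
    simp [mul_assoc, ← Finset.mul_sum, hx c hc]

/-- `Q` is a stabilizer code obtained by the Hermitian construction from the code `C` over `K`,
where `#F = q` and `#K = q ^ 2`: for a basis `γ, γ ^ q` of `K` over `F`, the space `Q` is a joint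
eigenspace of the operators `X(a) Z(b)` with `γ a + γ ^ q b` in the Hermitian dual of `C`. -/
def IsHermitianStabilizerCode {F K : Type*} [Field F] [Fintype F] [Field K] [Algebra F K] {n : ℕ}
    (C : Submodule K (Fin n → K)) (Q : Submodule ℂ (QuditSpace F n)) : Prop :=
  ∃ γ : K, LinearIndependent F ![γ, γ ^ Fintype.card F] ∧
    ∃ μ : (Fin n → F) → (Fin n → F) → ℂ, ∀ v : QuditSpace F n,
      v ∈ Q ↔ ∀ a b : Fin n → F,
        (fun i => γ * algebraMap F K (a i) + γ ^ Fintype.card F * algebraMap F K (b i)) ∈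
            hermitianDual (Fintype.card F) C →
          errorX a (errorZ b v) = μ a b • v

end

/-! Cancelling `q ^ m - 1`, the bound on `δ` says `δ * (q ^ m + 1) ≤ n`, so sums `j * q ^ e + s`
with `j, s < δ` and `e ≤ m` stay below `n`, and congruences mod `n` between such numbers become
equalities. Hence the `q ^ 2`-cosets of the `s < δ` with `q ^ 2 ∤ s` are disjoint of full size `m`
(`eq_of_mul_pow_modEq_mul_pow`), which gives the dimension of the BCH code `C`, and they avoid their
images under `-q` (`not_dvd_mul_add_mul_pow`), which puts the Hermitian dual inside `C`.

The Hermitian construction (`exists_pure_subsystemCode`) does the rest. The errors labelled by the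
dual commute, and a trace computation gives their joint eigenspace `Q` dimension `q ^ (2 dim C -
n)`. By the BCH bound a nonscalar error of weight below `δ` has its label outside `C`, so it fails
to commute with some stabilizing error and sends `Q` to its orthogonal complement. So `P E P` is
zero or, for the trivial error, `P`; it is detectable for every tensor decomposition of `Q`, which
leaves `r` free. -/

noncomputable section

/-! ### The additive character of the finite field. -/

section TraceCharacter

variable {F : Type*} [Field F] [Fintype F]

theorem traceCharacter_add (x y : F) :
    traceCharacter F (x + y) = traceCharacter F x * traceCharacter F y := by
  simp [traceCharacter, AddChar.map_add_eq_mul]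

theorem traceCharacter_zero : traceCharacter F 0 = 1 := by
  simp [traceCharacter]

theorem norm_traceCharacter (x : F) : ‖traceCharacter F x‖ = 1 := by
  have : NeZero (ringChar F) := ⟨CharP.ringChar_ne_zero_of_finite F⟩
  exact AddChar.norm_apply _ _

theorem traceCharacter_ne_zero (x : F) : traceCharacter F x ≠ 0 := by
  intro h
  simpa [h] using norm_traceCharacter x

theorem exists_traceCharacter_ne_one : ∃ u : F, traceCharacter F u ≠ 1 := by
  have : NeZero (ringChar F) := ⟨CharP.ringChar_ne_zero_of_finite F⟩
  let _ : Algebra (ZMod (ringChar F)) F := ZMod.algebra F (ringChar F)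
  obtain ⟨b, hb⟩ := FiniteField.trace_to_zmod_nondegenerate F (one_ne_zero (α := F))
  refine ⟨1 * b, fun h => hb ?_⟩
  have h' : ZMod.stdAddChar (N := ringChar F) (Algebra.trace (ZMod (ringChar F)) F (1 * b))
      = ZMod.stdAddChar (N := ringChar F) 0 := by
    rw [AddChar.map_zero_eq_one]; exact h
  exact ZMod.injective_stdAddChar h'

/-- Translating `x` by a vector whose product with `b` is `u` multiplies the sum by `traceCharacter
F u`, which can be chosen different from 1. -/
theorem sum_traceCharacter_dotProduct {n : ℕ} {b : Fin n → F} (hb : b ≠ 0) :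
    ∑ x : Fin n → F, traceCharacter F (∑ i, b i * x i) = 0 := by
  obtain ⟨j, hj⟩ : ∃ j, b j ≠ 0 := by
    by_contra! h
    exact hb (funext h)
  obtain ⟨u, hu⟩ := exists_traceCharacter_ne_one (F := F)
  have key : traceCharacter F u * ∑ x : Fin n → F, traceCharacter F (∑ i, b i * x i)
      = ∑ x : Fin n → F, traceCharacter F (∑ i, b i * x i) := by
    rw [Finset.mul_sum]
    refine Fintype.sum_equiv (Equiv.addRight (Pi.single j (u / b j))) _ _ fun x => ?_
    rw [← traceCharacter_add]
    congr 1
    simp [mul_add, Finset.sum_add_distrib, Pi.single_apply, mul_div_cancel₀ _ hj, add_comm]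
  by_contra h
  exact hu (mul_right_cancel₀ h (by rw [key, one_mul]))

end TraceCharacter

/-! ### Commutation, unitarity and trace of the errors. -/

section ErrorOperators

variable {F : Type*} [Field F] [Fintype F] {n : ℕ}

/-- The error operator `X(a) Z(b)` labelled by the pair `(a, b)`. -/
def errorOp (v : (Fin n → F) × (Fin n → F)) : QuditSpace F n →ₗ[ℂ] QuditSpace F n :=
  errorX v.1 ∘ₗ errorZ v.2

theorem errorOp_apply (v : (Fin n → F) × (Fin n → F)) (x : QuditSpace F n) (y : Fin n → F) :
    errorOp v x y = traceCharacter F (∑ i, v.2 i * (y i - v.1 i)) * x (y - v.1) := rfl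

theorem errorOp_zero : errorOp (0 : (Fin n → F) × (Fin n → F)) = LinearMap.id := by
  ext x y
  simp [errorOp_apply, traceCharacter_zero]

theorem errorOp_mul (v w : (Fin n → F) × (Fin n → F)) (x : QuditSpace F n) :
    errorOp v (errorOp w x) =
      traceCharacter F (∑ i, v.2 i * w.1 i) • errorOp (v + w) x := by
  ext y
  simp only [errorOp_apply, PiLp.smul_apply, smul_eq_mul, Prod.fst_add, Prod.snd_add, Pi.add_apply,
    Pi.sub_apply, ← mul_assoc, ← traceCharacter_add]
  rw [sub_sub]
  congr 2
  simp only [← Finset.sum_add_distrib]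
  exact Finset.sum_congr rfl fun i _ => by ring

theorem errorOp_comm (v w : (Fin n → F) × (Fin n → F)) (x : QuditSpace F n) :
    errorOp v (errorOp w x) =
      traceCharacter F (∑ i, (v.2 i * w.1 i - w.2 i * v.1 i)) • errorOp w (errorOp v x) := by
  rw [errorOp_mul v w, errorOp_mul w v, smul_smul, ← traceCharacter_add, add_comm w v,
    Finset.sum_sub_distrib, sub_add_cancel]

theorem inner_errorOp (v : (Fin n → F) × (Fin n → F)) (x y : QuditSpace F n) :
    inner ℂ (errorOp v x) (errorOp v y) = inner ℂ x y := by
  simp only [PiLp.inner_apply, errorOp_apply]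
  refine Fintype.sum_equiv (Equiv.subRight v.1) _ _ fun z => ?_
  have h := norm_traceCharacter (∑ i, v.2 i * (z i - v.1 i))
  set c := traceCharacter F (∑ i, v.2 i * (z i - v.1 i))
  rw [← smul_eq_mul, ← smul_eq_mul, inner_smul_left, inner_smul_right, ← mul_assoc,
    Complex.conj_mul', h]
  simp

/-- A nonzero shift moves every basis vector, so the diagonal vanishes; without a shift the trace is
a nontrivial character sum. -/
theorem trace_errorOp_of_ne_zero {v : (Fin n → F) × (Fin n → F)} (hv : v ≠ 0) :
    LinearMap.trace ℂ _ (errorOp v) = 0 := by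
  classical
  rw [LinearMap.trace_eq_sum_inner (errorOp v) (EuclideanSpace.basisFun (Fin n → F) ℂ)]
  have h (x : Fin n → F) : inner ℂ (EuclideanSpace.basisFun (Fin n → F) ℂ x)
      (errorOp v (EuclideanSpace.basisFun (Fin n → F) ℂ x)) =
      if v.1 = 0 then traceCharacter F (∑ i, v.2 i * x i) else 0 := by
    rw [EuclideanSpace.basisFun_apply, EuclideanSpace.inner_single_left, errorOp_apply]
    split_ifs with h
    · simp [h]
    · simp [h]
  rw [Finset.sum_congr rfl fun x _ => h x]
  split_ifs with h0
  · exact sum_traceCharacter_dotProduct fun h1 => hv (Prod.ext h0 h1)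
  · simp

end ErrorOperators

/-! ### Stabilizer codes as joint eigenspaces. -/

section StabilizerCode

variable {F : Type*} [Field F] [Fintype F] {n : ℕ}

/-- The joint eigenspace of the errors in `V` for the eigenvalues `μ`. -/
def jointEigenspace (V : AddSubgroup ((Fin n → F) × (Fin n → F)))
    (μ : (Fin n → F) × (Fin n → F) → ℂ) : Submodule ℂ (QuditSpace F n) where
  carrier := {x | ∀ v ∈ V, errorOp v x = μ v • x}
  zero_mem' := by intro v _; simp
  add_mem' := by
    intro x y hx hy v hv
    rw [map_add, hx v hv, hy v hv, smul_add]
  smul_mem' := by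
    intro t x hx v hv
    rw [map_smul, hx v hv, smul_comm]

theorem mem_jointEigenspace {V : AddSubgroup ((Fin n → F) × (Fin n → F))}
    {μ : (Fin n → F) × (Fin n → F) → ℂ} {x : QuditSpace F n} :
    x ∈ jointEigenspace V μ ↔ ∀ v ∈ V, errorOp v x = μ v • x := Iff.rfl

/-- Commuting operators on a nonzero complex space of finite dimension have a joint eigenvector. -/
theorem exists_joint_eigenvector {E ι : Type*} [AddCommGroup E] [Module ℂ E]
    [FiniteDimensional ℂ E] [Nontrivial E] (f : ι → Module.End ℂ E)
    (hf : ∀ i j, Commute (f i) (f j)) :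
    ∃ x : E, x ≠ 0 ∧ ∃ μ : ι → ℂ, ∀ i, f i x = μ i • x := by
  have key (d : ℕ) : ∀ W : Submodule ℂ E, W ≠ ⊥ → Module.finrank ℂ W = d →
      (∀ i, ∀ x ∈ W, f i x ∈ W) → ∃ x : E, x ≠ 0 ∧ ∃ μ : ι → ℂ, ∀ i, f i x = μ i • x := by
    induction d using Nat.strong_induction_on with
    | _ d ih =>
      intro W hW hd hinv
      -- If some `f i` is not scalar on `W`, one of its eigenspaces cuts `W` down to a smaller
      -- nonzero subspace, invariant because the operators commute.
      by_cases hsc : ∀ i, ∃ c : ℂ, ∀ x ∈ W, f i x = c • x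
      · choose μ hμ using hsc
        obtain ⟨x, hx, hx0⟩ := W.ne_bot_iff.1 hW
        exact ⟨x, hx0, μ, fun i => hμ i x hx⟩
      · push Not at hsc
        obtain ⟨i, hi⟩ := hsc
        have : Nontrivial W := Submodule.nontrivial_iff_ne_bot.2 hW
        obtain ⟨c, hc⟩ := Module.End.exists_eigenvalue ((f i).restrict (hinv i))
        obtain ⟨x, hx⟩ := hc.exists_hasEigenvector
        have hxe : f i (x : E) = c • (x : E) := congrArg Subtype.val hx.apply_eq_smul
        refine ih (Module.finrank ℂ ↥(W ⊓ (f i).eigenspace c)) ?_ (W ⊓ (f i).eigenspace c) ?_ rfl ?_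
        · rw [← hd]
          refine Submodule.finrank_lt_finrank_of_lt (lt_of_le_of_ne inf_le_left fun he => ?_)
          obtain ⟨y, hy, hyc⟩ := hi c
          rw [← he] at hy
          exact hyc (Module.End.mem_eigenspace_iff.1 hy.2)
        · exact (Submodule.ne_bot_iff _).2 ⟨x, ⟨x.2, Module.End.mem_eigenspace_iff.2 hxe⟩,
            fun h0 => hx.2 (Subtype.ext h0)⟩
        · intro j y hy
          refine ⟨hinv j y hy.1, Module.End.mem_eigenspace_iff.2 ?_⟩
          have := Module.End.mem_eigenspace_iff.1 hy.2
          have hc := LinearMap.congr_fun (hf i j).eq y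
          simp only [Module.End.mul_apply] at hc
          rw [hc, this, map_smul]
  exact key _ ⊤ top_ne_bot rfl fun i x _ => Submodule.mem_top

/-- A totally isotropic group `V` of errors has a joint eigenspace of dimension `q ^ n / #V`. -/
theorem exists_jointEigenspace (V : AddSubgroup ((Fin n → F) × (Fin n → F)))
    (hV : ∀ v ∈ V, ∀ w ∈ V, ∑ i, (v.2 i * w.1 i - w.2 i * v.1 i) = 0) :
    ∃ μ : (Fin n → F) × (Fin n → F) → ℂ, jointEigenspace V μ ≠ ⊥ ∧
      Module.finrank ℂ (jointEigenspace V μ) * Nat.card V = Fintype.card F ^ n := by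
  classical
  obtain ⟨x, hx0, ν, hν⟩ := exists_joint_eigenvector (fun v : V => errorOp (v : (Fin n → F) × (Fin n → F))) (by
    intro v w
    refine LinearMap.ext fun x => ?_
    simp only [Module.End.mul_apply]
    rw [errorOp_comm, hV v v.2 w w.2, traceCharacter_zero, one_smul])
  set μ : (Fin n → F) × (Fin n → F) → ℂ := fun v => if h : v ∈ V then ν ⟨v, h⟩ else 0 with hμdef
  have hμ (v : V) : errorOp v.1 x = μ v • x := by
    rw [hν v, hμdef]; simp
  have hμmul (v w : V) : μ v * μ w =
      traceCharacter F (∑ i, v.1.2 i * w.1.1 i) * μ (v + w : V) := by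
    have h := errorOp_mul v.1 w.1 x
    rw [hμ w, map_smul, hμ v, ← AddSubgroup.coe_add, hμ (v + w), smul_smul, smul_smul] at h
    rw [mul_comm]
    exact smul_left_injective ℂ hx0 h
  have hμ0 : μ (0 : V) = 1 := by
    have h := hμ 0
    rw [AddSubgroup.coe_zero, errorOp_zero, LinearMap.id_apply] at h
    exact (smul_left_injective ℂ hx0 (by simpa using h)).symm
  have hμne (v : V) : μ v ≠ 0 := by
    intro h0
    have h := hμmul v (-v)
    rw [h0, zero_mul, add_neg_cancel, hμ0, mul_one] at h
    exact traceCharacter_ne_zero _ h.symm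
  refine ⟨μ, (Submodule.ne_bot_iff _).2 ⟨x, fun v hv => hμ ⟨v, hv⟩, hx0⟩, ?_⟩
  -- The average of the errors, normalized by their eigenvalues, projects onto the eigenspace. Its
  -- trace is the dimension, and only the identity contributes to it.
  set P : QuditSpace F n →ₗ[ℂ] QuditSpace F n :=
    (Fintype.card V : ℂ)⁻¹ • ∑ v : V, (μ v)⁻¹ • errorOp v.1 with hP
  have hcard : (Fintype.card V : ℂ) ≠ 0 := by simp
  have hPapp (y : QuditSpace F n) :
      P y = (Fintype.card V : ℂ)⁻¹ • ∑ v : V, (μ v)⁻¹ • errorOp v.1 y := by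
    simp [hP, LinearMap.sum_apply]
  have hproj : LinearMap.IsProj (jointEigenspace V μ) P := by
    constructor
    · intro y w hw
      lift w to V using hw
      rw [hPapp, map_smul, smul_comm (μ w.1), map_sum]
      congr 1
      rw [Finset.smul_sum]
      refine Fintype.sum_equiv (Equiv.addLeft w) _ _ fun v => ?_
      rw [map_smul, errorOp_mul, smul_smul, smul_smul, Equiv.coe_addLeft, AddSubgroup.coe_add]
      congr 1
      have h := hμmul w v
      have h1 := hμne v
      have h2 := hμne (w + v)
      rw [AddSubgroup.coe_add] at h h2
      field_simp
      rw [← h, mul_comm]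
    · intro y hy
      have hs (v : V) : (μ v)⁻¹ • errorOp v.1 y = y := by
        rw [hy v v.2, smul_smul, inv_mul_cancel₀ (hμne v), one_smul]
      rw [hPapp, Finset.sum_congr rfl fun v _ => hs v, Finset.sum_const, Finset.card_univ, ← Nat.cast_smul_eq_nsmul ℂ, smul_smul,
        inv_mul_cancel₀ hcard, one_smul]
  have htr := hproj.trace
  rw [hP, map_smul, map_sum, Finset.sum_eq_single (0 : V), map_smul, hμ0, AddSubgroup.coe_zero,
    errorOp_zero, LinearMap.trace_id, finrank_euclideanSpace] at htr
  · rw [Nat.card_eq_fintype_card]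
    have h : ((Fintype.card F ^ n : ℕ) : ℂ) =
        Module.finrank ℂ (jointEigenspace V μ) * Fintype.card V := by
      rw [← htr]
      simp only [smul_eq_mul, inv_one, one_mul, Fintype.card_fun, Fintype.card_fin]
      field_simp
    exact_mod_cast h.symm
  · intro v _ hv
    rw [map_smul, trace_errorOp_of_ne_zero fun h => hv (Subtype.ext h), smul_zero]
  · simp

/-- An error that does not commute with some error in `V` maps the joint eigenspace of `V` to its
orthogonal complement. -/
theorem errorOp_mem_orthogonal_jointEigenspace {V : AddSubgroup ((Fin n → F) × (Fin n → F))}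
    {μ : (Fin n → F) × (Fin n → F) → ℂ} {v w : (Fin n → F) × (Fin n → F)} (hw : w ∈ V)
    (hvw : traceCharacter F (∑ i, (w.2 i * v.1 i - v.2 i * w.1 i)) ≠ 1) {x : QuditSpace F n}
    (hx : x ∈ jointEigenspace V μ) : errorOp v x ∈ (jointEigenspace V μ)ᗮ := by
  rw [Submodule.mem_orthogonal']
  intro y hy
  set c := traceCharacter F (∑ i, (w.2 i * v.1 i - v.2 i * w.1 i)) with hc
  rcases eq_or_ne x 0 with rfl | hx0
  · simp
  have hμ : (starRingEnd ℂ) (μ w) * μ w = 1 := by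
    have h := inner_errorOp w x x
    rw [hx w hw, inner_smul_left, inner_smul_right, ← mul_assoc] at h
    exact mul_right_cancel₀ (inner_self_ne_zero.2 hx0) (by rw [h, one_mul])
  -- Applying the unitary `w` to both arguments multiplies the inner product by `conj c ≠ 1`, since
  -- the two unimodular eigenvalues cancel.
  have h := inner_errorOp w (errorOp v x) y
  rw [errorOp_comm w v, hx w hw, hy w hw, map_smul, ← hc, inner_smul_left, inner_smul_left,
    inner_smul_right, mul_left_comm ((starRingEnd ℂ) (μ w)), mul_comm (μ w), mul_comm _ (μ w)] at h
  by_contra h0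
  apply hvw
  have h1 : (starRingEnd ℂ) c = 1 := by
    refine mul_right_cancel₀ h0 ?_
    rw [one_mul]
    nth_rewrite 2 [← h]
    have : ∀ a b c d : ℂ, d * b = 1 → a * (c) = a * c * (d * b) := by
      intro a b c d h; rw [h, mul_one]
    rw [this _ _ _ _ hμ]
    ring
  simpa using congrArg (starRingEnd ℂ) h1

/-- Every space of dimension `q ^ (k + r)` has a decomposition into subsystems. -/
theorem exists_subsystemCode {k r : ℕ} (Q : Submodule ℂ (QuditSpace F n))
    (hQ : Module.finrank ℂ Q = Fintype.card F ^ (k + r)) :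
    ∃ S : SubsystemCode F n k r, S.space = Q := by
  have h : Module.finrank ℂ (EuclideanSpace ℂ (Fin (Fintype.card F ^ k)) ⊗[ℂ]
      EuclideanSpace ℂ (Fin (Fintype.card F ^ r))) = Module.finrank ℂ Q := by
    rw [hQ, Module.finrank_tensorProduct, finrank_euclideanSpace_fin, finrank_euclideanSpace_fin,
      pow_add]
  exact ⟨⟨Q, (stdOrthonormalBasis ℂ _).equiv (stdOrthonormalBasis ℂ Q) (finCongr h)⟩, rfl⟩

/-- An error of weight zero is the identity, so `T = 1` works; for the others purity allows `T = 0`.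
-/
theorem SubsystemCode.PureTo.distanceGE {k r d : ℕ} {S : SubsystemCode F n k r}
    (hS : S.PureTo d) : S.DistanceGE d := by
  intro a b hab
  rcases Nat.eq_zero_or_pos (errorWeight a b) with h0 | hpos
  · have hz : ((a, b) : (Fin n → F) × (Fin n → F)) = 0 := by
      rw [errorWeight, Set.ncard_eq_zero] at h0
      have h (i : Fin n) : a i = 0 ∧ b i = 0 := by
        by_contra hi
        have : i ∈ {i : Fin n | a i ≠ 0 ∨ b i ≠ 0} := by
          simp only [Set.mem_ofPred_eq]; tauto
        simp [h0] at this
      exact Prod.ext (funext fun i => (h i).1) (funext fun i => (h i).2)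
    refine ⟨LinearMap.id, fun u => ?_⟩
    change S.space.starProjection (errorOp (a, b) _) = _
    rw [hz, errorOp_zero, LinearMap.lTensor_id, LinearMap.id_apply, LinearMap.id_apply,
      Submodule.starProjection_eq_self_iff]
    exact (S.decomp u).2
  · refine ⟨0, fun u => ?_⟩
    rw [LinearMap.lTensor_zero, LinearMap.zero_apply, map_zero, Submodule.coe_zero]
    exact (Submodule.starProjection_apply_eq_zero_iff _).2 (hS a b hpos hab _ (S.decomp u).2)

end StabilizerCode

/-! ### Hermitian duality of codes. -/

section HermitianDual

variable {K : Type*} [Field K] {n q : ℕ}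

theorem pow_pow_of_card_eq_sq [Fintype K] (hK : Fintype.card K = q ^ 2) (x : K) : (x ^ q) ^ q = x := by
  rw [← pow_mul, ← sq, ← hK, FiniteField.pow_card]

theorem exists_ringHom_pow (hq : ∃ p k : ℕ, p.Prime ∧ CharP K p ∧ q = p ^ k) :
    ∃ φ : K →+* K, ∀ x, φ x = x ^ q := by
  obtain ⟨p, k, hp, hchar, rfl⟩ := hq
  have : Fact p.Prime := ⟨hp⟩
  exact ⟨iterateFrobenius K p k, fun x => iterateFrobenius_def p k x⟩

theorem exists_prime_pow_of_card_eq (F : Type*) [Field F] [Fintype F] [Algebra F K]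
    (hF : Fintype.card F = q) : ∃ p k : ℕ, p.Prime ∧ CharP K p ∧ q = p ^ k := by
  obtain ⟨k, hp, hk⟩ := FiniteField.card F (ringChar F)
  exact ⟨ringChar F, k, hp, (Algebra.charP_iff F K _).1 inferInstance, by rw [← hF, hk]⟩

theorem dotProduct_isRefl :
    LinearMap.BilinForm.IsRefl (dotProductBilin K K : LinearMap.BilinForm K (Fin n → K)) := by
  intro x y h
  change y ⬝ᵥ x = 0
  rw [dotProduct_comm]
  exact h

theorem dotProduct_nondegenerate : (dotProductBilin K K (m := Fin n) (A := K)).Nondegenerate := by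
  refine ⟨fun x hx => dotProduct_eq_zero x hx, fun x hx => dotProduct_eq_zero x fun y => ?_⟩
  rw [dotProduct_comm]
  exact hx y

variable [Fintype K] (φ : K →+* K) (hφ : ∀ x, φ x = x ^ q) (hK : Fintype.card K = q ^ 2)
include hφ hK

theorem sum_mul_pow_pow (x c : Fin n → K) :
    (∑ i, x i * c i ^ q) ^ q = ∑ i, x i ^ q * c i := by
  simp only [← hφ, map_sum, map_mul]
  simp only [hφ, pow_pow_of_card_eq_sq hK]

theorem sum_pow_mul_eq_zero {C : Submodule K (Fin n → K)} {x : Fin n → K}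
    (hx : x ∈ hermitianDual q C) {c : Fin n → K} (hc : c ∈ C) : ∑ i, x i ^ q * c i = 0 := by
  have hq : q ≠ 0 := by
    rintro rfl
    simp at hK
  rw [← sum_mul_pow_pow φ hφ hK, hx c hc, zero_pow hq]

/-- The coordinatewise `q`-th power is an involution that turns Hermitian into Euclidean
orthogonality, so dimension and double-dual facts for bilinear forms carry over. -/
theorem mem_hermitianDual_iff_pow_mem_orthogonal {C : Submodule K (Fin n → K)} {x : Fin n → K} :
    x ∈ hermitianDual q C ↔
      (fun i => x i ^ q) ∈ LinearMap.BilinForm.orthogonal (dotProductBilin K K) C := by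
  have hq : q ≠ 0 := by
    rintro rfl
    simp at hK
  have h (c : Fin n → K) : ∑ i, x i * c i ^ q = 0 ↔ c ⬝ᵥ (fun i => x i ^ q) = 0 := by
    rw [dotProduct_comm, dotProduct, ← sum_mul_pow_pow φ hφ hK, pow_eq_zero_iff hq]
  exact forall₂_congr fun c _ => h c

theorem card_hermitianDual (C : Submodule K (Fin n → K)) :
    Nat.card (hermitianDual q C) = q ^ (2 * (n - Module.finrank K C)) := by
  have e : hermitianDual q C ≃ LinearMap.BilinForm.orthogonal (dotProductBilin K K) C :=
    { toFun := fun x => ⟨fun i => x.1 i ^ q,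
        (mem_hermitianDual_iff_pow_mem_orthogonal φ hφ hK).1 x.2⟩
      invFun := fun y => ⟨fun i => y.1 i ^ q, by
        rw [mem_hermitianDual_iff_pow_mem_orthogonal φ hφ hK]
        simp only [pow_pow_of_card_eq_sq hK]
        exact y.2⟩
      left_inv := fun x => Subtype.ext (funext fun i => pow_pow_of_card_eq_sq hK _)
      right_inv := fun x => Subtype.ext (funext fun i => pow_pow_of_card_eq_sq hK _) }
  rw [Nat.card_congr e, Module.natCard_eq_pow_finrank (K := K), Nat.card_eq_fintype_card, hK,
    LinearMap.BilinForm.finrank_orthogonal dotProduct_nondegenerate, Module.finrank_fin_fun,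
    pow_mul]

theorem mem_of_forall_mem_hermitianDual {C : Submodule K (Fin n → K)} {v : Fin n → K}
    (hv : ∀ w ∈ hermitianDual q C, ∑ i, v i * w i ^ q = 0) : v ∈ C := by
  rw [← LinearMap.BilinForm.orthogonal_orthogonal dotProduct_nondegenerate dotProduct_isRefl C]
  intro y hy
  have h := hv (fun i => y i ^ q) (by
    rw [mem_hermitianDual_iff_pow_mem_orthogonal φ hφ hK]
    simp only [pow_pow_of_card_eq_sq hK]
    exact hy)
  simp only [pow_pow_of_card_eq_sq hK] at h
  change y ⬝ᵥ v = 0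
  rw [dotProduct_comm]
  exact h

end HermitianDual

/-! ### From Hermitian duals to pure subsystem codes. -/

section HermitianConstruction

variable {F K : Type*} [Field F] [Fintype F] [Field K] [Fintype K] [Algebra F K] {n q : ℕ}

/-- A generator `g` of `Kˣ` works: dependence would put `g ^ (q - 1)` in `F`, so the order `q ^ 2 -
1` of `g` would divide the smaller positive number `(q - 1) ^ 2`. -/
theorem exists_linearIndependent_pow (hF : Fintype.card F = q) (hK : Fintype.card K = q ^ 2) :
    ∃ γ : K, LinearIndependent F ![γ, γ ^ q] := by
  have hq : 1 < q := hF ▸ Fintype.one_lt_card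
  obtain ⟨g, hg⟩ := IsCyclic.exists_generator (α := Kˣ)
  refine ⟨g, ?_⟩
  rw [LinearIndependent.pair_iff' g.ne_zero]
  intro a ha
  have horder : orderOf g = q ^ 2 - 1 := by
    rw [orderOf_eq_card_of_forall_mem_zpowers hg, Nat.card_units, Nat.card_eq_fintype_card, hK]
  obtain ⟨s, rfl⟩ : ∃ s, q = s + 2 := ⟨q - 2, by lia⟩
  have hga : algebraMap F K a = (g : K) ^ (s + 1) := by
    rw [Algebra.smul_def, pow_succ (g : K) (s + 1)] at ha
    exact mul_right_cancel₀ g.ne_zero ha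
  have ha0 : a ≠ 0 := by
    rintro rfl
    rw [map_zero] at hga
    exact pow_ne_zero _ g.ne_zero hga.symm
  have h1 : g ^ ((s + 1) * (s + 1)) = 1 := by
    ext
    rw [Units.val_pow_eq_pow_val, pow_mul, ← hga, ← map_pow, Units.val_one]
    have := FiniteField.pow_card_sub_one_eq_one a ha0
    rw [hF] at this
    rw [show s + 1 = s + 2 - 1 from rfl, this, map_one]
  have h2 := Nat.le_of_dvd (by positivity) (orderOf_dvd_of_pow_eq_one h1)
  rw [horder] at h2
  have h3 : (s + 2) ^ 2 = (s + 1) * (s + 1) + 2 * s + 3 := by ring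
  lia

/-- The map `(a, b) ↦ γ a + γ ^ q b`. -/
def hermitianLabel (F : Type*) {K : Type*} [Field F] [Field K] [Algebra F K] {n : ℕ} (q : ℕ)
    (γ : K) : (Fin n → F) × (Fin n → F) →+ (Fin n → K) where
  toFun v i := γ * algebraMap F K (v.1 i) + γ ^ q * algebraMap F K (v.2 i)
  map_zero' := by ext i; simp
  map_add' v w := by ext i; simp; ring

omit [Fintype F] [Fintype K] in
theorem hermitianLabel_apply (γ : K) (v : (Fin n → F) × (Fin n → F)) (i : Fin n) :
    hermitianLabel F q γ v i = γ * algebraMap F K (v.1 i) + γ ^ q * algebraMap F K (v.2 i) := rfl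

variable {γ : K} (hγ : LinearIndependent F ![γ, γ ^ q])
include hγ

omit [Fintype F] [Fintype K] in
theorem hermitianLabel_apply_eq_zero_iff (v : (Fin n → F) × (Fin n → F)) (i : Fin n) :
    hermitianLabel F q γ v i = 0 ↔ v.1 i = 0 ∧ v.2 i = 0 := by
  refine ⟨fun h => LinearIndependent.pair_iff.1 hγ _ _ ?_, fun h => ?_⟩
  · rw [hermitianLabel_apply] at h
    rw [Algebra.smul_def, Algebra.smul_def, mul_comm, mul_comm _ (γ ^ q), h]
  · simp [hermitianLabel_apply, h]

omit [Fintype F] [Fintype K] in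
theorem hermitianLabel_injective :
    Function.Injective (hermitianLabel F q γ : (Fin n → F) × (Fin n → F) →+ (Fin n → K)) := by
  rw [injective_iff_map_eq_zero]
  intro v hv
  have h (i : Fin n) := (hermitianLabel_apply_eq_zero_iff hγ v i).1 (congrFun hv i)
  exact Prod.ext (funext fun i => (h i).1) (funext fun i => (h i).2)

theorem hermitianLabel_bijective (hF : Fintype.card F = q) (hK : Fintype.card K = q ^ 2) :
    Function.Bijective (hermitianLabel F q γ : (Fin n → F) × (Fin n → F) →+ (Fin n → K)) := by
  classical
  rw [Fintype.bijective_iff_injective_and_card]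
  refine ⟨hermitianLabel_injective hγ, ?_⟩
  rw [Fintype.card_prod, Fintype.card_fun, Fintype.card_fun, hF, hK, Fintype.card_fin]
  ring

omit [Fintype F] [Fintype K] in
theorem sq_sub_sq_pow_ne_zero : 
    γ ^ 2 - (γ ^ q) ^ 2 ≠ 0 := by
  intro h
  rw [sq_sub_sq] at h
  rcases mul_eq_zero.1 h with h | h
  · have := (LinearIndependent.pair_iff.1 hγ 1 1 (by simpa using h)).1
    exact one_ne_zero this
  · have := (LinearIndependent.pair_iff.1 hγ 1 (-1) (by simpa [sub_eq_add_neg] using h)).1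
    exact one_ne_zero this

omit hγ in
/-- The trace-symplectic form of two labels in terms of the Hermitian form. -/
theorem sum_hermitianLabel_sub (hF : Fintype.card F = q) (hK : Fintype.card K = q ^ 2)
    (φ : K →+* K) (hφ : ∀ x, φ x = x ^ q) (γ : K) (v w : (Fin n → F) × (Fin n → F)) :
    (γ ^ 2 - (γ ^ q) ^ 2) * algebraMap F K (∑ i, (w.2 i * v.1 i - v.2 i * w.1 i)) =
      ∑ i, hermitianLabel F q γ v i * hermitianLabel F q γ w i ^ q -
        (∑ i, hermitianLabel F q γ v i * hermitianLabel F q γ w i ^ q) ^ q := by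
  -- Conjugation swaps `γ` and `γ ^ q` and fixes `F`, so in the difference only the mixed products
  -- of `v.1` with `w.2` and of `v.2` with `w.1` survive.
  have hpow (v : (Fin n → F) × (Fin n → F)) (i : Fin n) : hermitianLabel F q γ v i ^ q =
      γ ^ q * algebraMap F K (v.1 i) + γ * algebraMap F K (v.2 i) := by
    rw [← hφ, hermitianLabel_apply, map_add, map_mul, map_mul, hφ, hφ, hφ, hφ,
      pow_pow_of_card_eq_sq hK, ← map_pow, ← map_pow, ← hF, FiniteField.pow_card,
      FiniteField.pow_card]
  rw [sum_mul_pow_pow φ hφ hK, ← Finset.sum_sub_distrib, map_sum, Finset.mul_sum]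
  refine Finset.sum_congr rfl fun i _ => ?_
  rw [hpow, hpow, hermitianLabel_apply, hermitianLabel_apply, map_sub, map_mul, map_mul]
  ring

/-- The Hermitian construction: a code over a field of order `q ^ 2` that contains its Hermitian
dual and has minimum distance at least `d` gives subsystem codes that are pure up to `d`. -/
theorem exists_pure_subsystemCode (hF : Fintype.card F = q) (hK : Fintype.card K = q ^ 2)
    (C : Submodule K (Fin n → K)) (hC : hermitianDual q C ≤ C) {d : ℕ}
    (hd : ∀ c ∈ C, c ≠ 0 → d ≤ {i | c i ≠ 0}.ncard) {k r : ℕ}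
    (hkr : k + r + n = 2 * Module.finrank K C) :
    ∃ S : SubsystemCode F n k r,
      S.DistanceGE d ∧ S.PureTo d ∧ IsHermitianStabilizerCode C S.space := by
  have hq : 1 < q := hF ▸ Fintype.one_lt_card
  obtain ⟨φ, hφ⟩ := exists_ringHom_pow (exists_prime_pow_of_card_eq (K := K) F hF)
  have hbij := hermitianLabel_bijective (n := n) hγ hF hK
  have hsub := sq_sub_sq_pow_ne_zero hγ
  set V : AddSubgroup ((Fin n → F) × (Fin n → F)) :=
    (hermitianDual q C).toAddSubgroup.comap (hermitianLabel F q γ) with hVdef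
  have hmemV (v : (Fin n → F) × (Fin n → F)) :
      v ∈ V ↔ hermitianLabel F q γ v ∈ hermitianDual q C := Iff.rfl
  have hcardV : Nat.card V = q ^ (2 * (n - Module.finrank K C)) := by
    rw [← card_hermitianDual φ hφ hK C]
    exact Nat.card_congr ((Equiv.ofBijective _ hbij).subtypeEquiv fun v => hmemV v)
  obtain ⟨μ, -, hrank⟩ := exists_jointEigenspace V (by
    intro v hv w hw
    have h := sum_hermitianLabel_sub hF hK φ hφ γ w v
    rw [hw _ (hC hv), zero_pow (by lia), sub_zero, mul_eq_zero, or_iff_right hsub] at h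
    exact (map_eq_zero _).1 h)
  have hCn : Module.finrank K C ≤ n := by
    simpa using Submodule.finrank_le C
  have hdim : Module.finrank ℂ (jointEigenspace V μ) = Fintype.card F ^ (k + r) := by
    rw [hcardV, hF] at hrank
    rw [hF]
    refine Nat.eq_of_mul_eq_mul_right (pow_pos (by lia : 0 < q) _) (hrank.trans ?_)
    rw [← pow_add]
    congr 1
    lia
  obtain ⟨S, hS⟩ := exists_subsystemCode (k := k) (r := r) _ hdim
  have hpure : S.PureTo d := by
    intro a b h0 hlt x hx
    rw [hS] at hx ⊢
    set v : (Fin n → F) × (Fin n → F) := (a, b) with hv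
    have hsupp : {i | hermitianLabel F q γ v i ≠ 0} = {i | a i ≠ 0 ∨ b i ≠ 0} := by
      ext i
      rw [Set.mem_ofPred_eq, Set.mem_ofPred_eq, Ne, hermitianLabel_apply_eq_zero_iff hγ, not_and_or]
    have hnot : hermitianLabel F q γ v ∉ C := by
      intro hmem
      have h := hd _ hmem (by
        intro hz
        rw [errorWeight, ← hsupp, hz] at h0
        simp at h0)
      rw [hsupp] at h
      exact absurd hlt (not_lt.2 h)
    obtain ⟨w, hw, hvw⟩ : ∃ w ∈ hermitianDual q C,
        ∑ i, hermitianLabel F q γ v i * w i ^ q ≠ 0 := by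
      by_contra! h
      exact hnot (mem_of_forall_mem_hermitianDual φ hφ hK h)
    obtain ⟨u, hu⟩ := exists_traceCharacter_ne_one (F := F)
    set s := ∑ i, hermitianLabel F q γ v i * w i ^ q with hs
    -- The dual is `K`-linear, so `w` may be rescaled until its Hermitian product with the label of
    -- `v` is `u γ ^ 2`. Subtracting the conjugate leaves `u (γ ^ 2 - (γ ^ q) ^ 2)`, so the
    -- symplectic product is exactly `u`.
    obtain ⟨w', hw'⟩ := hbij.2 (((algebraMap F K u * γ ^ 2 / s) ^ q) • w)
    refine errorOp_mem_orthogonal_jointEigenspace (v := v) (w := w') ?_ ?_ hx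
    · rw [hmemV, hw']
      exact Submodule.smul_mem _ _ hw
    · have h := sum_hermitianLabel_sub hF hK φ hφ γ v w'
      have hsum : ∑ i, hermitianLabel F q γ v i * hermitianLabel F q γ w' i ^ q =
          algebraMap F K u * γ ^ 2 := by
        rw [hw']
        simp only [Pi.smul_apply, smul_eq_mul, mul_pow, pow_pow_of_card_eq_sq hK]
        simp only [mul_left_comm _ (algebraMap F K u * γ ^ 2 / s)]
        rw [← Finset.mul_sum, ← hs, div_mul_cancel₀ _ hvw]
      rw [hsum, mul_pow, ← map_pow, ← hF, FiniteField.pow_card, hF,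
        pow_right_comm γ 2 q, ← mul_sub, mul_comm] at h
      rwa [(algebraMap F K).injective (mul_right_cancel₀ hsub h)]
  refine ⟨S, hpure.distanceGE, hpure, γ, hF ▸ hγ, fun a b => μ (a, b), fun x => ?_⟩
  rw [hS, mem_jointEigenspace, hF]
  exact ⟨fun h a b hab => h (a, b) hab, fun h v hv => h v.1 v.2 hv⟩

end HermitianConstruction

/-! ### Cyclic codes, their duals and the BCH bound. -/

section CyclicCode

open Polynomial

variable {K L : Type*} [Field K] [Field L] [Algebra K L]

/-- The cyclic code of length `n` over `K` with zeros `R`. -/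
def codeWithZeros (K : Type*) {L : Type*} [Field K] [Field L] [Algebra K L] (n : ℕ)
    (R : Finset L) : Submodule K (Fin n → K) where
  carrier := {c | ∀ ρ ∈ R, ∑ i, algebraMap K L (c i) * ρ ^ (i : ℕ) = 0}
  zero_mem' := by intro ρ _; simp
  add_mem' := by
    intro c c' hc hc' ρ hρ
    simp [add_mul, Finset.sum_add_distrib, hc ρ hρ, hc' ρ hρ]
  smul_mem' := by
    intro t c hc ρ hρ
    simp [mul_assoc, ← Finset.mul_sum, hc ρ hρ]

theorem mem_range_algebraMap_of_pow_card_eq [Fintype K] {c : L} (hc : c ^ Fintype.card K = c) :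
    c ∈ Set.range (algebraMap K L) := by
  classical
  have hroots := FiniteField.roots_X_pow_card_sub_X K
  have hne : (X ^ Fintype.card K - X : K[X]) ≠ 0 :=
    FiniteField.X_pow_card_sub_X_ne_zero K Fintype.one_lt_card
  have hdeg := FiniteField.X_pow_card_sub_X_natDegree_eq K (Fintype.one_lt_card (α := K))
  have hsplit : (X ^ Fintype.card K - X : K[X]).Splits := by
    rw [splits_iff_card_roots, hroots, hdeg]
    rfl
  exact hsplit.mem_range_of_isRoot hne (by simp [hc])

theorem prod_X_sub_C_dvd_iff (R : Finset L) (f : L[X]) :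
    ∏ ρ ∈ R, (X - C ρ) ∣ f ↔ ∀ ρ ∈ R, f.eval ρ = 0 := by
  refine ⟨fun h ρ hρ => ?_, fun h => ?_⟩
  · exact dvd_iff_isRoot.1 ((Finset.dvd_prod_of_mem (fun ρ => X - C ρ) hρ).trans h)
  · refine Finset.prod_dvd_of_coprime ?_ fun ρ hρ => dvd_iff_isRoot.2 (h ρ hρ)
    intro a _ b _ hab
    exact pairwise_coprime_X_sub_C Function.injective_id hab

/-- A set of zeros that is closed under the Frobenius map has a generator polynomial. -/
theorem exists_generator_polynomial [Fintype K] (R : Finset L)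
    (hR : ∀ ρ ∈ R, ρ ^ Fintype.card K ∈ R) :
    ∃ g : K[X], g.Monic ∧ g.natDegree = R.card ∧
      g.map (algebraMap K L) = ∏ ρ ∈ R, (X - C ρ) := by
  set P : L[X] := ∏ ρ ∈ R, (X - C ρ) with hP
  let φ : L →ₐ[K] L := FiniteField.frobeniusAlgHom K L
  have hφ (x : L) : φ x = x ^ Fintype.card K := rfl
  have hinj : Function.Injective φ := φ.toRingHom.injective
  classical
  have himage : R.image φ = R := by
    refine Finset.eq_of_subset_of_card_le (fun x hx => ?_) ?_
    · obtain ⟨ρ, hρ, rfl⟩ := Finset.mem_image.1 hx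
      exact hR ρ hρ
    · rw [Finset.card_image_of_injective _ hinj]
  -- Frobenius permutes the roots of `P`, hence fixes its coefficients, which therefore lie in `K`.
  have hmap : P.map (φ : L →+* L) = P := by
    rw [hP, Polynomial.map_prod]
    nth_rewrite 2 [← himage]
    rw [Finset.prod_image (hinj.injOn)]
    simp
  have hmonic : P.Monic := monic_prod_of_monic _ _ fun ρ _ => monic_X_sub_C ρ
  have hlift : P ∈ lifts (algebraMap K L) := by
    rw [lifts_iff_coeff_lifts]
    intro i
    refine mem_range_algebraMap_of_pow_card_eq ?_
    rw [← hφ]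
    conv_rhs => rw [← hmap, coeff_map]
    rfl
  obtain ⟨g, hg, hdeg, hgm⟩ := lifts_and_natDegree_eq_and_monic hlift hmonic
  refine ⟨g, hgm, ?_, hg⟩
  rw [hdeg, hP, natDegree_prod_of_monic _ _ fun ρ _ => monic_X_sub_C ρ]
  simp

theorem dvd_iff_aeval_eq_zero {R : Finset L} {g : K[X]}
    (hg : g.map (algebraMap K L) = ∏ ρ ∈ R, (X - C ρ)) (f : K[X]) :
    g ∣ f ↔ ∀ ρ ∈ R, aeval ρ f = 0 := by
  rw [← map_dvd_map' (algebraMap K L), hg, prod_X_sub_C_dvd_iff]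
  simp only [eval_map_algebraMap]

theorem sum_coeff_eq_aeval {n : ℕ} {f : K[X]} (hf : f ∈ degreeLT K n) (ρ : L) :
    ∑ i : Fin n, algebraMap K L (f.coeff i) * ρ ^ (i : ℕ) = aeval ρ f := by
  rcases eq_or_ne f 0 with rfl | hf0
  · simp
  · rw [aeval_eq_sum_range' ((natDegree_lt_iff_degree_lt hf0).2 (mem_degreeLT.1 hf)),
      ← Fin.sum_univ_eq_sum_range (fun i => f.coeff i • ρ ^ i)]
    simp only [Algebra.smul_def]

theorem coeff_mem_codeWithZeros_iff {n : ℕ} {f : K[X]} (hf : f ∈ degreeLT K n) {R : Finset L}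
    {g : K[X]} (hg : g.map (algebraMap K L) = ∏ ρ ∈ R, (X - C ρ)) :
    (fun i : Fin n => f.coeff i) ∈ codeWithZeros K n R ↔ g ∣ f := by
  rw [dvd_iff_aeval_eq_zero hg]
  exact forall₂_congr fun ρ _ => by rw [sum_coeff_eq_aeval hf]

/-- The code is the kernel of reduction modulo its generator polynomial on polynomials of degree
below `n`, and the reduction attains every remainder. -/
theorem finrank_codeWithZeros [Fintype K] {n : ℕ} {R : Finset L}
    (hR : ∀ ρ ∈ R, ρ ^ Fintype.card K ∈ R) (hRn : R.card ≤ n) :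
    Module.finrank K (codeWithZeros K n R) + R.card = n := by
  obtain ⟨g, hgm, hdeg, hg⟩ := exists_generator_polynomial R hR
  let e := degreeLTEquiv K n
  let T : (Fin n → K) →ₗ[K] K[X] := modByMonicHom g ∘ₗ (degreeLT K n).subtype ∘ₗ e.symm
  have hT (c : Fin n → K) : T c = (e.symm c : K[X]) %ₘ g := rfl
  have hker : LinearMap.ker T = codeWithZeros K n R := by
    ext c
    have h := coeff_mem_codeWithZeros_iff (e.symm c).2 hg
    have hc : (fun i : Fin n => (e.symm c : K[X]).coeff i) = c := e.apply_symm_apply c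
    rw [hc] at h
    rw [h, LinearMap.mem_ker, hT, modByMonic_eq_zero_iff_dvd hgm]
  have hrange : LinearMap.range T = degreeLT K R.card := by
    refine le_antisymm ?_ fun f hf => ?_
    · rintro _ ⟨c, rfl⟩
      rw [mem_degreeLT, hT, ← hdeg, ← degree_eq_natDegree hgm.ne_zero]
      exact degree_modByMonic_lt _ hgm
    · have hfn : f ∈ degreeLT K n := degreeLT_mono hRn hf
      refine ⟨e ⟨f, hfn⟩, ?_⟩
      rw [hT, LinearEquiv.symm_apply_apply, modByMonic_eq_self_iff hgm,
        degree_eq_natDegree hgm.ne_zero, hdeg]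
      exact mem_degreeLT.1 hf
  have h := LinearMap.finrank_range_add_finrank_ker T
  rw [hker, hrange, (degreeLTEquiv K R.card).finrank_eq, Module.finrank_fin_fun,
    Module.finrank_fin_fun] at h
  rw [add_comm, h]

/-- A vector orthogonal to a cyclic code vanishes at the inverses of the nonzeros of the code. -/
theorem sum_mul_pow_eq_zero_of_orthogonal [Fintype K] {n : ℕ} {R : Finset L}
    (hR : ∀ ρ ∈ R, ρ ^ Fintype.card K ∈ R) (hRn : ∀ ρ ∈ R, ρ ^ n = 1) {y : Fin n → K}
    (hy : ∀ c ∈ codeWithZeros K n R, ∑ i, y i * c i = 0) {w : L} (hw : w ^ n = 1)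
    (hwR : ∀ ρ ∈ R, w * ρ ≠ 1) : ∑ i, algebraMap K L (y i) * w ^ (i : ℕ) = 0 := by
  obtain ⟨g, hgm, hdeg, hg⟩ := exists_generator_polynomial R hR
  rcases Nat.eq_zero_or_pos n with rfl | hn
  · simp
  -- At a zero `ρ` this is the geometric sum of `w * ρ`, an `n`-th root of unity other than 1, so it
  -- vanishes. Thus `g` divides `h` over `L`, and the vector of the `w ^ i` is an `L`-combination of
  -- shifts of `g`, which are codewords.
  set h : L[X] := ∑ i ∈ Finset.range n, C (w ^ i) * X ^ i with hh
  have hcoeff (i : Fin n) : h.coeff i = w ^ (i : ℕ) := by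
    simp [hh, finsetSum_coeff, -map_pow, coeff_C_mul, coeff_X_pow]
  have hdvd : g.map (algebraMap K L) ∣ h := by
    rw [hg, prod_X_sub_C_dvd_iff]
    intro ρ hρ
    have h1 : h.eval ρ = ∑ i ∈ Finset.range n, (w * ρ) ^ i := by
      simp [hh, eval_finsetSum, mul_pow]
    have h2 := geom_sum_mul (w * ρ) n
    rw [mul_pow, hw, hRn ρ hρ, one_mul, sub_self] at h2
    rw [h1]
    exact (mul_eq_zero.1 h2).resolve_right (sub_ne_zero.2 (hwR ρ hρ))
  obtain ⟨u, hu⟩ := hdvd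
  have hh0 : h ≠ 0 := by
    intro h0
    have := hcoeff ⟨0, hn⟩
    simp [h0] at this
  have hu0 : u ≠ 0 := by
    rintro rfl
    exact hh0 (by rw [hu, mul_zero])
  have hhdeg : h.natDegree < n := by
    refine (natDegree_lt_iff_degree_lt hh0).2 ?_
    rw [← mem_degreeLT, hh]
    exact Submodule.sum_mem _ fun i hi => mem_degreeLT.2
      ((degree_C_mul_X_pow_le _ _).trans_lt (by exact_mod_cast Finset.mem_range.1 hi))
  have hgu : g.natDegree + u.natDegree < n := by
    rwa [hu, natDegree_mul (by simpa using hgm.ne_zero) hu0, natDegree_map] at hhdeg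
  have hshift (l : ℕ) (hl : l < u.natDegree + 1) :
      ∑ i : Fin n, algebraMap K L (y i) * algebraMap K L ((g * X ^ l).coeff i) = 0 := by
    have hmem : g * X ^ l ∈ degreeLT K n := by
      rw [mem_degreeLT, ← natDegree_lt_iff_degree_lt (mul_ne_zero hgm.ne_zero (by simp)),
        natDegree_mul hgm.ne_zero (by simp), natDegree_X_pow]
      lia
    have := hy _ ((coeff_mem_codeWithZeros_iff hmem hg).2 (dvd_mul_right g _))
    simp only [← map_mul, ← map_sum, this, map_zero]
  have hexp (i : Fin n) : w ^ (i : ℕ) = ∑ l ∈ Finset.range (u.natDegree + 1),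
      u.coeff l * algebraMap K L ((g * X ^ l).coeff i) := by
    rw [← hcoeff, hu]
    nth_rewrite 1 [u.as_sum_range_C_mul_X_pow]
    rw [Finset.mul_sum, finsetSum_coeff]
    refine Finset.sum_congr rfl fun l _ => ?_
    rw [mul_left_comm, coeff_C_mul, ← coeff_map, Polynomial.map_mul, Polynomial.map_pow, map_X]
  simp only [hexp, Finset.mul_sum]
  rw [Finset.sum_comm]
  refine Finset.sum_eq_zero fun l hl => ?_
  simp only [mul_left_comm _ (u.coeff l)]
  rw [← Finset.mul_sum, hshift l (Finset.mem_range.1 hl), mul_zero]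

/-- The BCH bound. -/
theorem le_ncard_support_of_mem_bchCode {n δ : ℕ} {β : L} (hβ : IsPrimitiveRoot β n)
    {c : Fin n → K} (hc : c ∈ bchCode n δ β) (hc0 : c ≠ 0) : δ ≤ {i | c i ≠ 0}.ncard := by
  classical
  by_contra! hlt
  have hfin : {i | c i ≠ 0}.ncard = (Finset.univ.filter fun i => c i ≠ 0).card := by
    rw [← Set.ncard_coe_finset]
    simp
  rw [hfin] at hlt
  set T := Finset.univ.filter fun i => c i ≠ 0 with hT
  obtain ⟨i₀, hi₀⟩ : ∃ i, c i ≠ 0 := by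
    by_contra! h
    exact hc0 (funext h)
  have hn : 0 < n := i₀.pos
  have hβ0 : β ≠ 0 := hβ.ne_zero hn.ne'
  have hmem : i₀ ∈ T := by simp [hT, hi₀]
  -- `P` vanishes at every support locator except that of `i₀`, so weighting `c` by its values
  -- leaves one term. The factor `X` removes the constant coefficient, where nothing is known about
  -- `c`, and the degree remains below `δ`.
  set P : L[X] := X * ∏ l ∈ T.erase i₀, (X - C (β ^ (l : ℕ))) with hP
  have hPdeg : P.natDegree < δ := by
    have h1 : (∏ l ∈ T.erase i₀, (X - C (β ^ (l : ℕ)))).natDegree = T.card - 1 := by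
      rw [natDegree_prod_of_monic _ _ fun l _ => monic_X_sub_C _]
      simp [-map_pow, Finset.card_erase_of_mem hmem]
    have h2 := natDegree_mul_le (p := (X : L[X])) (q := ∏ l ∈ T.erase i₀, (X - C (β ^ (l : ℕ))))
    rw [h1, natDegree_X] at h2
    have h3 := Finset.card_pos.2 ⟨i₀, hmem⟩
    rw [hP]
    lia
  have hsum : ∑ i, algebraMap K L (c i) * P.eval (β ^ (i : ℕ)) = 0 := by
    simp only [eval_eq_sum_range' hPdeg, Finset.mul_sum]
    rw [Finset.sum_comm]
    refine Finset.sum_eq_zero fun j hj => ?_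
    rcases Nat.eq_zero_or_pos j with rfl | hj0
    · simp [hP]
    · have := hc j hj0 (Finset.mem_range.1 hj)
      simp only [mul_left_comm _ (P.coeff j)]
      rw [← Finset.mul_sum, ← mul_zero (P.coeff j), ← this]
      congr 1
      exact Finset.sum_congr rfl fun i _ => by rw [pow_right_comm]
  rw [Finset.sum_eq_single i₀] at hsum
  · rcases mul_eq_zero.1 hsum with h | h
    · exact hi₀ ((map_eq_zero _).1 h)
    · rw [hP, eval_mul, eval_X, eval_prod, mul_eq_zero,
        or_iff_right (pow_ne_zero _ hβ0), Finset.prod_eq_zero_iff] at h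
      obtain ⟨l, hl, hl0⟩ := h
      rw [eval_sub, eval_X, eval_C, sub_eq_zero] at hl0
      exact (Finset.mem_erase.1 hl).1 (Fin.ext (hβ.pow_inj i₀.2 l.2 hl0)).symm
  · intro i _ hi
    by_cases hci : c i = 0
    · simp [hci]
    · have : i ∈ T.erase i₀ := Finset.mem_erase.2 ⟨hi, by simp [hT, hci]⟩
      rw [hP, eval_mul, eval_prod, Finset.prod_eq_zero this (by simp)]
      simp
  · simp

end CyclicCode

/-! ### Arithmetic of cyclotomic cosets. -/

section CyclotomicCosets

variable {n q m D : ℕ}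

theorem one_modEq_pow_of_orderOf (hm : m = orderOf ((q : ZMod n) ^ 2)) :
    q ^ (2 * m) ≡ 1 [MOD n] := by
  rw [← ZMod.natCast_eq_natCast_iff]
  push_cast
  rw [pow_mul, hm, pow_orderOf_eq_one]

theorem not_dvd_mul_pow_add (hq : 0 < q) (hD : D * (q ^ m + 1) < n) {j s e : ℕ} (he : e ≤ m)
    (hj : j ≤ D) (hs0 : 0 < s) (hs : s ≤ D) : ¬ n ∣ j * q ^ e + s := by
  intro h
  have h1 := Nat.le_of_dvd (by positivity) h
  have h2 : j * q ^ e ≤ D * q ^ m := Nat.mul_le_mul hj (Nat.pow_le_pow_right hq he)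
  lia

/-- The cyclotomic cosets of small exponents are disjoint from their images under `-q`. -/
theorem not_dvd_mul_add_mul_pow (hq : 0 < q) (hqn : Nat.Coprime q n)
    (hqm : q ^ (2 * m) ≡ 1 [MOD n]) (hD : D * (q ^ m + 1) < n) {j s i : ℕ} (hi : i < m)
    (hj0 : 0 < j) (hj : j ≤ D) (hs0 : 0 < s) (hs : s ≤ D) : ¬ n ∣ j * q + s * q ^ (2 * i) := by
  intro h
  rcases Nat.eq_zero_or_pos i with rfl | hi0
  · exact not_dvd_mul_pow_add (e := 1) hq hD (by lia) hj hs0 hs (by simpa using h)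
  -- Either cancel `q`, leaving exponent `2 * i - 1`, or multiply by `q ^ (2 * m - 2 * i)` and use
  -- `q ^ (2 * m) ≡ 1`, leaving exponent `2 * m - 2 * i + 1`. Both are at most `m`.
  rcases le_or_gt (2 * i) m with hle | hgt
  · obtain ⟨t, rfl⟩ : ∃ t, i = t + 1 := ⟨i - 1, by lia⟩
    have h' : j * q + s * q ^ (2 * (t + 1)) = q * (s * q ^ (2 * t + 1) + j) := by ring
    rw [h'] at h
    exact not_dvd_mul_pow_add hq hD (by lia) hs hj0 hj (hqn.symm.dvd_of_dvd_mul_left h)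
  · have h1 : j * q ^ (2 * m - 2 * i + 1) + s * q ^ (2 * m) =
        (j * q + s * q ^ (2 * i)) * q ^ (2 * m - 2 * i) := by
      rw [show 2 * m = 2 * i + (2 * m - 2 * i) by lia, add_tsub_cancel_left, pow_add, pow_succ]
      ring
    have h2 : n ∣ j * q ^ (2 * m - 2 * i + 1) + s * q ^ (2 * m) := h1 ▸ h.mul_right _
    have h3 : j * q ^ (2 * m - 2 * i + 1) + s * q ^ (2 * m) ≡
        j * q ^ (2 * m - 2 * i + 1) + s [MOD n] := by
      simpa using (hqm.mul_left s).add_left (j * q ^ (2 * m - 2 * i + 1))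
    exact not_dvd_mul_pow_add hq hD (by lia) hj hs0 hs ((h3.dvd_iff dvd_rfl).1 h2)

/-- For `2 * t ≤ m` both sides are below `n`, hence equal, and `t > 0` would force `q ^ 2 ∣ s`. For
larger `t`, multiplying by `q ^ (2 * (m - t))` exchanges `s` and `s'`, and the same argument yields
`m - t = 0`, which is impossible. -/
theorem eq_of_modEq_mul_pow (hq : 0 < q) (hqm : q ^ (2 * m) ≡ 1 [MOD n])
    (hD : D * (q ^ m + 1) < n) {s s' t : ℕ} (ht : t < m) (hs : s ≤ D) (hs' : s' ≤ D)
    (hd : ¬ q ^ 2 ∣ s) (hd' : ¬ q ^ 2 ∣ s') (h : s ≡ s' * q ^ (2 * t) [MOD n]) :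
    s = s' ∧ t = 0 := by
  have aux {a b e : ℕ} (ha : a ≤ D) (hb : b ≤ D) (he : 2 * e ≤ m) (hda : ¬ q ^ 2 ∣ a)
      (hab : a ≡ b * q ^ (2 * e) [MOD n]) : a = b ∧ e = 0 := by
    have h1 : b * q ^ (2 * e) ≤ D * q ^ m := Nat.mul_le_mul hb (Nat.pow_le_pow_right hq he)
    have h2 : a ≤ D * q ^ m := ha.trans (Nat.le_mul_of_pos_right _ (by positivity))
    have h3 : D * (q ^ m + 1) = D * q ^ m + D := by ring
    have h4 := Nat.ModEq.eq_of_lt_of_lt hab (by lia) (by lia)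
    rcases Nat.eq_zero_or_pos e with rfl | he0
    · simpa using h4
    · exact absurd (h4 ▸ ((pow_dvd_pow q (by lia)).mul_left b)) hda
  rcases le_or_gt (2 * t) m with hle | hgt
  · exact aux hs hs' hle hd h
  · have h1 := h.mul_right (q ^ (2 * (m - t)))
    rw [mul_assoc, ← pow_add, show 2 * t + 2 * (m - t) = 2 * m by lia] at h1
    have h2 := (h1.trans (hqm.mul_left s')).symm
    rw [mul_one] at h2
    have := aux hs' hs (by lia) hd' h2
    lia

theorem eq_of_mul_pow_modEq_mul_pow (hq : 0 < q) (hqn : Nat.Coprime q n)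
    (hqm : q ^ (2 * m) ≡ 1 [MOD n]) (hD : D * (q ^ m + 1) < n) {s s' j j' : ℕ} (hj : j < m)
    (hj' : j' < m) (hs : s ≤ D) (hs' : s' ≤ D) (hd : ¬ q ^ 2 ∣ s) (hd' : ¬ q ^ 2 ∣ s')
    (h : s * q ^ (2 * j) ≡ s' * q ^ (2 * j') [MOD n]) : s = s' ∧ j = j' := by
  wlog hle : j ≤ j' generalizing s s' j j'
  · have := this hj' hj hs' hs hd' hd h.symm (by lia)
    exact ⟨this.1.symm, this.2.symm⟩
  obtain ⟨t, rfl⟩ := Nat.exists_eq_add_of_le hle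
  rw [show s' * q ^ (2 * (j + t)) = s' * q ^ (2 * t) * q ^ (2 * j) by ring] at h
  have h1 := Nat.ModEq.cancel_right_of_coprime (by
    simpa [Nat.coprime_iff_gcd_eq_one] using (hqn.symm.pow_right (2 * j))) h
  have := eq_of_modEq_mul_pow hq hqm hD (by lia) hs hs' hd hd' h1
  exact ⟨this.1, by lia⟩

/-- The positive integers below `δ` that are not divisible by `q ^ 2`. -/
def cosetReps (q δ : ℕ) : Finset ℕ := {s ∈ Finset.Ico 1 δ | ¬ q ^ 2 ∣ s}

theorem mem_cosetReps {q δ s : ℕ} : s ∈ cosetReps q δ ↔ (1 ≤ s ∧ s < δ) ∧ ¬ q ^ 2 ∣ s := by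
  simp [cosetReps]

/-- With `D = δ - 1`, both sides are `D - ⌊D / q ^ 2⌋`. -/
theorem card_cosetReps {q δ : ℕ} (hδ : 1 ≤ δ) :
    ((cosetReps q δ).card : ℤ) = ⌈((δ : ℚ) - 1) * (1 - 1 / (q : ℚ) ^ 2)⌉ := by
  obtain ⟨D, rfl⟩ : ∃ D, δ = D + 1 := ⟨δ - 1, by lia⟩
  have hIoc : Finset.Ico 1 (D + 1) = Finset.Ioc 0 D := by
    ext; simp; lia
  have h1 := Finset.card_filter_add_card_filter_not (s := Finset.Ioc 0 D) (fun s => q ^ 2 ∣ s)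
  rw [Nat.Ioc_filter_dvd_card_eq_div, Nat.card_Ioc] at h1
  have h2 : ((D + 1 : ℕ) - 1 : ℚ) * (1 - 1 / (q : ℚ) ^ 2) = D + -((D : ℕ) / (q ^ 2 : ℕ) : ℚ) := by
    push_cast
    ring
  rw [h2, Int.ceil_natCast_add, Int.ceil_neg, Rat.floor_natCast_div_natCast, cosetReps, hIoc]
  have h3 : ((D / q ^ 2 : ℕ) : ℤ) = ((D : ℕ) : ℤ) / ((q ^ 2 : ℕ) : ℤ) := Int.natCast_ediv _ _
  lia

theorem exists_cosetReps_mul_pow {q δ j : ℕ} (hq : 1 < q) (hj0 : 1 ≤ j) (hj : j < δ) :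
    ∃ s ∈ cosetReps q δ, ∃ i, j = s * q ^ (2 * i) := by
  obtain ⟨i, s, hs, rfl⟩ := Nat.exists_eq_pow_mul_and_not_dvd (n := j) (by lia) (q ^ 2)
    (by have := Nat.one_lt_pow two_ne_zero hq; lia)
  have hpos : 0 < (q ^ 2) ^ i := by positivity
  refine ⟨s, mem_cosetReps.2 ⟨⟨?_, ?_⟩, hs⟩, i, by rw [← pow_mul, mul_comm]⟩
  · exact Nat.pos_of_ne_zero fun h => by simp [h] at hs
  · exact (Nat.le_mul_of_pos_left s hpos).trans_lt hj

end CyclotomicCosets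

/-! ### Dimension and dual containment of BCH codes. -/

section BCH

variable {K L : Type*} [Field K] [Field L] [Algebra K L] {n q m δ : ℕ} {β : L}

/-- The zeros of the narrow-sense BCH code over a field of order `q ^ 2`. -/
def bchZeros (q m δ : ℕ) (β : L) : Finset L :=
  open Classical in
  (cosetReps q δ ×ˢ Finset.range m).image fun x => β ^ (x.1 * q ^ (2 * x.2))

theorem mem_bchZeros {ρ : L} : ρ ∈ bchZeros q m δ β ↔
    ∃ s ∈ cosetReps q δ, ∃ j < m, β ^ (s * q ^ (2 * j)) = ρ := by
  simp only [bchZeros, Finset.mem_image, Finset.mem_product, Finset.mem_range, Prod.exists]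
  exact ⟨fun ⟨s, j, h, e⟩ => ⟨s, h.1, j, h.2, e⟩, fun ⟨s, h, j, h', e⟩ => ⟨s, j, ⟨h, h'⟩, e⟩⟩

theorem pow_eq_pow_iff_modEq_of_primitive (hn : 0 < n) (hβ : IsPrimitiveRoot β n) {a b : ℕ} :
    β ^ a = β ^ b ↔ a ≡ b [MOD n] := by
  have h := IsOfFinOrder.pow_eq_pow_iff_modEq (x := β) (n := a) (m := b)
    (isOfFinOrder_iff_pow_eq_one.2 ⟨n, hn, hβ.pow_eq_one⟩)
  rwa [← hβ.eq_orderOf] at h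

theorem pow_mul_pow_mem_bchZeros (hn : 0 < n) (hβ : IsPrimitiveRoot β n) (hm0 : 0 < m)
    (hqm : q ^ (2 * m) ≡ 1 [MOD n]) {s : ℕ} (hs : s ∈ cosetReps q δ) (i : ℕ) :
    β ^ (s * q ^ (2 * i)) ∈ bchZeros q m δ β := by
  refine mem_bchZeros.2 ⟨s, hs, i % m, Nat.mod_lt _ hm0, ?_⟩
  rw [pow_eq_pow_iff_modEq_of_primitive hn hβ]
  refine Nat.ModEq.mul_left _ ?_
  conv_rhs => rw [← Nat.div_add_mod i m, mul_add, pow_add, ← mul_assoc, pow_mul]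
  simpa using ((hqm.pow (i / m)).mul_right (q ^ (2 * (i % m)))).symm

theorem pow_card_mem_bchZeros (hn : 0 < n) (hβ : IsPrimitiveRoot β n) (hm0 : 0 < m)
    (hqm : q ^ (2 * m) ≡ 1 [MOD n]) {ρ : L} (hρ : ρ ∈ bchZeros q m δ β) :
    ρ ^ q ^ 2 ∈ bchZeros q m δ β := by
  obtain ⟨s, hs, j, -, rfl⟩ := mem_bchZeros.1 hρ
  have := pow_mul_pow_mem_bchZeros (δ := δ) hn hβ hm0 hqm hs (j + 1)
  rwa [mul_add, mul_one, pow_add, ← mul_assoc, pow_mul] at this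

theorem card_bchZeros (hn : 0 < n) (hβ : IsPrimitiveRoot β n) (hq : 0 < q) (hqn : Nat.Coprime q n)
    (hqm : q ^ (2 * m) ≡ 1 [MOD n]) (hδ : (δ - 1) * (q ^ m + 1) < n) :
    (bchZeros q m δ β).card = m * (cosetReps q δ).card := by
  classical
  rw [bchZeros, Finset.card_image_of_injOn, Finset.card_product, Finset.card_range, mul_comm]
  rintro ⟨s, j⟩ h ⟨s', j'⟩ h' e
  simp only [Finset.coe_product, Set.mem_prod, Finset.mem_coe, Finset.mem_range,
    mem_cosetReps] at h h'
  have := eq_of_mul_pow_modEq_mul_pow hq hqn hqm hδ h.2 h'.2 (by lia) (by lia) h.1.2 h'.1.2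
    ((pow_eq_pow_iff_modEq_of_primitive hn hβ).1 e)
  exact Prod.ext this.1 this.2

/-- Since `c(x ^ q ^ 2) = c(x) ^ q ^ 2`, a zero propagates along its coset, and each exponent below
`δ` lies in the coset of a representative. -/
theorem bchCode_eq_codeWithZeros [Fintype K] (hK : Fintype.card K = q ^ 2) (hn : 0 < n) (hq : 1 < q)
    (hβ : IsPrimitiveRoot β n) (hm0 : 0 < m) (hqm : q ^ (2 * m) ≡ 1 [MOD n]) :
    (bchCode n δ β : Submodule K (Fin n → K)) = codeWithZeros K n (bchZeros q m δ β) := by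
  have hfrob (c : Fin n → K) (x : L) (j : ℕ) :
      ∑ i, algebraMap K L (c i) * (x ^ q ^ (2 * j)) ^ (i : ℕ) =
        (∑ i, algebraMap K L (c i) * x ^ (i : ℕ)) ^ q ^ (2 * j) := by
    have h (y : L) : (FiniteField.frobeniusAlgHom K L ^ j) y = y ^ q ^ (2 * j) := by
      rw [pow_mul, ← hK]
      induction j generalizing y with
      | zero => simp
      | succ j ih =>
        rw [pow_succ, AlgHom.mul_apply, ih, FiniteField.coe_frobeniusAlgHom, pow_succ, ← pow_mul,
          mul_comm]
    rw [← h (∑ i, _), map_sum]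
    refine Finset.sum_congr rfl fun i _ => ?_
    rw [map_mul, AlgHom.commutes, h, pow_right_comm]
  ext c
  refine ⟨fun hc ρ hρ => ?_, fun hc j hj0 hj => ?_⟩
  · obtain ⟨s, hs, j, -, rfl⟩ := mem_bchZeros.1 hρ
    rw [mem_cosetReps] at hs
    rw [pow_mul, hfrob, hc s hs.1.1 hs.1.2, zero_pow (by positivity)]
  · obtain ⟨s, hs, i, rfl⟩ := exists_cosetReps_mul_pow hq hj0 hj
    exact hc _ (pow_mul_pow_mem_bchZeros hn hβ hm0 hqm hs i)

/-- For `x` in the dual, the vector of the `x i ^ q` is orthogonal to the code, so it vanishes at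
inverses of nonzeros. By coset disjointness `β ^ (j * q)` is one, and the value there is `x(β ^ j) ^
q`. -/
theorem hermitianDual_bchCode_le [Fintype K] (hK : Fintype.card K = q ^ 2)
    (hprime : ∃ p k : ℕ, p.Prime ∧ CharP K p ∧ q = p ^ k) (hn : 0 < n)
    (hqn : Nat.Coprime q n) (hβ : IsPrimitiveRoot β n) (hm0 : 0 < m) (hqm : q ^ (2 * m) ≡ 1 [MOD n])
    (hδ : (δ - 1) * (q ^ m + 1) < n) :
    hermitianDual q (bchCode n δ β : Submodule K (Fin n → K)) ≤ bchCode n δ β := by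
  have hq : 1 < q := by
    have := hK ▸ Fintype.one_lt_card (α := K)
    exact (Nat.one_lt_pow_iff two_ne_zero).1 this
  obtain ⟨φ, hφ⟩ := exists_ringHom_pow hprime
  obtain ⟨ψ, hψ⟩ : ∃ ψ : L →+* L, ∀ x, ψ x = x ^ q := by
    obtain ⟨p, k, hp, hchar, hqp⟩ := hprime
    exact exists_ringHom_pow ⟨p, k, hp, (Algebra.charP_iff K L p).1 hchar, hqp⟩
  intro x hx j hj0 hj
  have hw : (β ^ (j * q)) ^ n = 1 := by
    rw [pow_right_comm, hβ.pow_eq_one, one_pow]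
  have key := sum_mul_pow_eq_zero_of_orthogonal (n := n) (R := bchZeros q m δ β)
    (y := fun i => x i ^ q) (w := β ^ (j * q))
    (fun ρ hρ => hK ▸ pow_card_mem_bchZeros hn hβ hm0 hqm hρ)
    (fun ρ hρ => by
      obtain ⟨s, -, i, -, rfl⟩ := mem_bchZeros.1 hρ
      rw [pow_right_comm, hβ.pow_eq_one, one_pow])
    (fun c hc => by
      rw [← bchCode_eq_codeWithZeros hK hn hq hβ hm0 hqm] at hc
      exact sum_pow_mul_eq_zero φ hφ hK hx hc)
    hw
    (fun ρ hρ h => by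
      obtain ⟨s, hs, i, hi, rfl⟩ := mem_bchZeros.1 hρ
      rw [mem_cosetReps] at hs
      rw [← pow_add, hβ.pow_eq_one_iff_dvd] at h
      exact not_dvd_mul_add_mul_pow (by lia) hqn hqm hδ hi hj0 (by lia) hs.1.1 (by lia) h)
  refine (pow_eq_zero_iff (n := q) (by lia)).1 (Eq.trans ?_ key)
  rw [← hψ, map_sum]
  refine Finset.sum_congr rfl fun i _ => ?_
  rw [map_mul, hψ, hψ, map_pow, pow_mul, pow_right_comm _ q]

end BCH

end

/-! ### The subsystem BCH codes. -/

theorem mainTheorem6 {F K : Type*} [Field F] [Fintype F] [Field K] [Fintype K] [Algebra F K]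
    (q n m δ : ℕ) (hF : Fintype.card F = q) (hK : Fintype.card K = q ^ 2)
    (hn : 0 < n) (hqn : Nat.Coprime q n)
    (hm : m = orderOf ((q : ZMod n) ^ 2))
    (hδ2 : 2 ≤ δ)
    (hδ : δ ≤ ⌊(n : ℚ) * ((q : ℚ) ^ m - 1) / ((q : ℚ) ^ (2 * m) - 1)⌋₊) :
    ∃ C : Submodule K (Fin n → K),
      IsNarrowSenseBCH δ C ∧
      hermitianDual q C ≤ C ∧
      (Module.finrank K C : ℤ) = n - m * ⌈((δ : ℚ) - 1) * (1 - 1 / (q : ℚ) ^ 2)⌉ ∧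
      ∀ r : ℕ, (r : ℤ) < n - 2 * m * ⌈((δ : ℚ) - 1) * (1 - 1 / (q : ℚ) ^ 2)⌉ →
        ∃ k : ℕ, (k : ℤ) = n - 2 * m * ⌈((δ : ℚ) - 1) * (1 - 1 / (q : ℚ) ^ 2)⌉ - r ∧
          ∃ S : SubsystemCode F n k r,
            S.DistanceGE δ ∧ S.PureTo δ ∧ IsHermitianStabilizerCode C S.space := by
  have hq : 1 < q := hF ▸ Fintype.one_lt_card
  have hprime := exists_prime_pow_of_card_eq (K := K) F hF
  have hqm := one_modEq_pow_of_orderOf hm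
  -- Coprimality makes `q` a unit mod `n`; otherwise `orderOf` could take its default value 0.
  have hm0 : 0 < m := by
    have : NeZero n := ⟨hn.ne'⟩
    rw [hm, ← ZMod.coe_unitOfCoprime q hqn, ← Units.val_pow_eq_pow_val, orderOf_units]
    exact orderOf_pos _
  have hδn : (δ - 1) * (q ^ m + 1) < n := by
    have hqm1 : (1 : ℚ) < (q : ℚ) ^ m := one_lt_pow₀ (by exact_mod_cast hq) hm0.ne'
    have hdiv : (n : ℚ) * ((q : ℚ) ^ m - 1) / ((q : ℚ) ^ (2 * m) - 1) = n / ((q : ℚ) ^ m + 1) := by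
      rw [mul_comm 2 m, pow_mul, show ((q : ℚ) ^ m) ^ 2 - 1 = ((q : ℚ) ^ m + 1) * ((q : ℚ) ^ m - 1)
        by ring, mul_div_mul_right _ _ (by linarith)]
    rw [hdiv, Nat.le_floor_iff (by positivity), le_div_iff₀ (by positivity)] at hδ
    have h1 : δ * (q ^ m + 1) ≤ n := by exact_mod_cast hδ
    exact (Nat.mul_lt_mul_of_pos_right (by lia) (by positivity)).trans_le h1
  -- The characteristic does not divide `n`, so primitive `n`-th roots of unity exist in the
  -- algebraic closure.
  have hnK : NeZero (n : K) := by
    obtain ⟨p, k, hp, hchar, rfl⟩ := hprime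
    refine ⟨fun h => ?_⟩
    have hpn := (CharP.cast_eq_zero_iff K p n).1 h
    have hk : k ≠ 0 := by
      rintro rfl
      simp at hq
    exact hp.one_lt.ne' (Nat.eq_one_of_dvd_coprimes hqn (dvd_pow_self p hk) hpn)
  obtain ⟨β, hβ⟩ := HasEnoughRootsOfUnity.exists_primitiveRoot (AlgebraicClosure K) n
  have hle := hermitianDual_bchCode_le hK hprime hn hqn hβ hm0 hqm hδn
  have hzeros := card_bchZeros hn hβ (by lia) hqn hqm hδn
  have hzn : (bchZeros q m δ β).card ≤ n := by
    refine le_trans (Finset.card_le_card fun ρ hρ => ?_)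
      (IsPrimitiveRoot.card_nthRootsFinset hβ).le
    obtain ⟨s, -, i, -, rfl⟩ := mem_bchZeros.1 hρ
    rw [Polynomial.mem_nthRootsFinset hn, pow_right_comm, hβ.pow_eq_one, one_pow]
  have hrank := finrank_codeWithZeros (K := K)
    (fun ρ hρ => hK ▸ pow_card_mem_bchZeros hn hβ hm0 hqm hρ) hzn
  rw [← bchCode_eq_codeWithZeros hK hn hq hβ hm0 hqm, hzeros] at hrank
  rw [← card_cosetReps (by lia)]
  refine ⟨bchCode n δ β, ⟨β, hβ, rfl⟩, hle, ?_, fun r hr => ?_⟩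
  · rw [eq_sub_iff_add_eq]
    exact_mod_cast hrank
  · set c := (cosetReps q δ).card
    obtain ⟨γ, hγ⟩ := exists_linearIndependent_pow hF hK
    have hr' : r + 2 * (m * c) < n := by
      zify
      linarith
    refine ⟨n - 2 * (m * c) - r, ?_, exists_pure_subsystemCode hγ hF hK _ hle
      (fun c hc hc0 => le_ncard_support_of_mem_bchCode hβ hc hc0) (by lia)⟩
    rw [Nat.cast_sub (by lia), Nat.cast_sub (by lia)]
    push_cast
    ring
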